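/- Write $\mathbb T=\mathbb R/\mathbb Z$ for the circle group, $\mathfrak c=|\mathbb R|$, $\mathbb N=\{0,1,2,\dots\}$, and $G[n]=\{x\in G: nx=0\}$ for an abelian group $G$ and $n\in\mathbb N$. A proper divisor of $n\in\mathbb N$ is a divisor $d\in\mathbb N$ of $n$ with $d\notin\{0,n\}$; thus every positive integer is a proper divisor of $0$. A subset $S$ of an abelian group $G$ is called almost $n$-torsion if $S$ is countably infinite, $S\subseteq G[n]$, and $\{x\in S: dx=g\}$ is finite for every $g\in G$ and every proper divisor $d$ of $n$. Let $\mathfrak T(G)$ be the family of all subsets of $G$ that are almost $n$-torsion for some $n\in\mathbb N$; for $E\in\mathfrak T(G)$ this $n$ is unique and is denoted by $n_E$. For a compact Hausdorff abelian group $K$, let $\mathrm{Hom}(G,K)$ be the set of all group homomorphisms from $G$ to $K$ with the topology of pointwise convergence, and $\mathrm{Mono}(G,K)$ its subset of injective homomorphisms; put $\widehat G=\mathrm{Hom}(G,\mathbb T)$, so that $\mathrm{Hom}(G,\mathbb T^{\mathfrak c})=\widehat G^{\,\mathfrak c}$ as topological spaces, where powers carry the product topology. A topological space has the Baire property if the intersection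 of every sequence of its dense open subsets is dense in it. **Theorem.** Let $G$ be an abelian group and let $\mathscr E\subseteq\mathfrak T(G)$ be a nonempty countable family. Put $$\Sigma_{G,\mathscr E}=\{\sigma\in\mathrm{Hom}(G,\mathbb T^{\mathfrak c}) : \sigma(E)\text{ is dense in }\mathbb T[n_E]^{\mathfrak c}\text{ for every }E\in\mathscr E\}.$$ Then: (i) $\Sigma_{G,\mathscr E}$ is a dense subset of $\mathrm{Hom}(G,\mathbb T^{\mathfrak c})=\widehat G^{\,\mathfrak c}$ which, as a subspace, has the Baire property; (ii) $\Sigma_{G,\mathscr E}\cap\mathrm{Mono}(G,\mathbb T^{\mathfrak c})$ is a dense subset of $\widehat G^{\,\mathfrak c}$ which, as a subspace, has the Baire property, if and only if $|G|\le 2^{\mathfrak c}$. -/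

import Mathlib

namespace KroneckerWeyl

/-- `d` is a proper divisor of `n`: `d ∣ n` and `d` is neither `0` nor `n`.
Every positive integer is a proper divisor of `0`. -/
def IsProperDivisor (d n : ℕ) : Prop := d ≠ 0 ∧ d ≠ n ∧ d ∣ n

/-- The subgroup `G[n] = {x ∈ G : n x = 0}`, as a set. -/
def torsionSet (G : Type*) [AddCommGroup G] (n : ℕ) : Set G := {x | n • x = 0}

/-- Almost `n`-torsion sets: countably infinite subsets `S` of `G[n]` such that
`{x ∈ S : d x = g}` is finite for every `g ∈ G` and every proper divisor `d` of `n`. -/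
structure IsAlmostTorsion {G : Type*} [AddCommGroup G] (n : ℕ) (S : Set G) : Prop where
  countable : S.Countable
  infinite : S.Infinite
  subset : S ⊆ torsionSet G n
  finite_fiber : ∀ d : ℕ, IsProperDivisor d n → ∀ g : G, {x | x ∈ S ∧ d • x = g}.Finite

/-- The family of all almost `n`-torsion sets in `G`. -/
def almostTorsionSetsOf (G : Type*) [AddCommGroup G] (n : ℕ) : Set (Set G) :=
  {S | IsAlmostTorsion n S}

/-- The family of all sets in `G` that are almost `n`-torsion for some natural number `n`. -/
def almostTorsionSets (G : Type*) [AddCommGroup G] : Set (Set G) :=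
  ⋃ n : ℕ, almostTorsionSetsOf G n

/-- The number `n` for which `E` is almost `n`-torsion (it is unique, see
`torsionIndex_eq`; the value is junk when there is none). -/
noncomputable def torsionIndex {G : Type*} [AddCommGroup G] (E : Set G) : ℕ :=
  sInf {n | IsAlmostTorsion n E}

theorem IsAlmostTorsion.eq_of_torsion {G : Type*} [AddCommGroup G] {n d : ℕ} {E : Set G}
    (hn : IsAlmostTorsion n E) (hd : E ⊆ torsionSet G d) (h0 : d ≠ 0) (hdvd : d ∣ n) :
    d = n := by
  by_contra hne
  refine hn.infinite ((hn.finite_fiber d ⟨h0, hne, hdvd⟩ 0).subset ?_)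
  exact fun x hx => ⟨hx, hd hx⟩

theorem IsAlmostTorsion.unique {G : Type*} [AddCommGroup G] {n m : ℕ} {E : Set G}
    (hn : IsAlmostTorsion n E) (hm : IsAlmostTorsion m E) : n = m := by
  by_cases h : n.gcd m = 0
  · rw [Nat.gcd_eq_zero_iff] at h
    rw [h.1, h.2]
  · have hd : E ⊆ torsionSet G (n.gcd m) := by
      intro x hx
      have h1 : addOrderOf x ∣ n := addOrderOf_dvd_of_nsmul_eq_zero (hn.subset hx)
      have h2 : addOrderOf x ∣ m := addOrderOf_dvd_of_nsmul_eq_zero (hm.subset hx)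
      exact addOrderOf_dvd_iff_nsmul_eq_zero.1 (Nat.dvd_gcd h1 h2)
    rw [← hn.eq_of_torsion hd h (Nat.gcd_dvd_left n m)]
    exact hm.eq_of_torsion hd h (Nat.gcd_dvd_right n m)

theorem torsionIndex_eq {G : Type*} [AddCommGroup G] {n : ℕ} {E : Set G}
    (hn : IsAlmostTorsion n E) : torsionIndex E = n :=
  IsAlmostTorsion.unique (Nat.sInf_mem (s := {n | IsAlmostTorsion n E}) ⟨n, hn⟩) hn

/-- The topology of pointwise convergence on the group `Hom(G, K)` of all homomorphisms. -/
instance homTopology (G K : Type*) [AddCommGroup G] [AddCommGroup K] [TopologicalSpace K] :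
    TopologicalSpace (G →+ K) :=
  TopologicalSpace.induced (fun σ : G →+ K => (σ : G → K)) inferInstance

/-- The identification `Hom(G, K ^ ι) = Hom(G, K) ^ ι` of topological spaces; for `K` the circle
group, the right-hand side is a power of the Pontryagin dual of the discrete group `G`. Density
and the Baire property of subsets may thus be stated on either side; the left one is used below. -/
def homPiHomeomorph (G K ι : Type*) [AddCommGroup G] [AddCommGroup K] [TopologicalSpace K] :
    (G →+ (ι → K)) ≃ₜ (ι → (G →+ K)) where
  toFun σ i := (Pi.evalAddMonoidHom (fun _ : ι => K) i).comp σ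
  invFun τ := AddMonoidHom.pi τ
  left_inv _ := rfl
  right_inv _ := rfl
  continuous_toFun := by
    refine continuous_pi fun i => continuous_induced_rng.2 (continuous_pi fun x => ?_)
    exact (continuous_apply i).comp ((continuous_apply x).comp continuous_induced_dom)
  continuous_invFun := by
    refine continuous_induced_rng.2 (continuous_pi fun x => continuous_pi fun i => ?_)
    have h : Continuous fun φ : G →+ K => (φ : G → K) := continuous_induced_dom
    exact (continuous_apply x).comp (h.comp (continuous_apply i))

/-- `A` is a dense subset of the subspace `B` of `X`. -/
def IsDenseIn {X : Type*} [TopologicalSpace X] (A B : Set X) : Prop :=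
  A ⊆ B ∧ B ⊆ closure A

/-- The set of all homomorphisms `σ : G → 𝕋 ^ ι` such that `σ(E)` is dense in `𝕋[n_E] ^ ι`
for every `E ∈ 𝓔`, where `𝕋 = ℝ / ℤ` and `n_E` is the index of `E`. -/
def sigmaSet {G : Type*} [AddCommGroup G] (ι : Type*) (𝓔 : Set (Set G)) :
    Set (G →+ (ι → UnitAddCircle)) :=
  {σ | ∀ E ∈ 𝓔, IsDenseIn (σ '' E)
    (Set.univ.pi fun _ : ι => torsionSet UnitAddCircle (torsionIndex E))}

/-- The set of all monomorphisms from `G` to `K`. -/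
def monoSet (G K : Type*) [AddCommGroup G] [AddCommGroup K] : Set (G →+ K) :=
  {σ | Function.Injective σ}

/-- `A` is a dense subset of `X` that, as a subspace, has the Baire property. -/
def IsDenseBaire {X : Type*} [TopologicalSpace X] (A : Set X) : Prop :=
  Dense A ∧ BaireSpace A

end KroneckerWeyl

/-!
A family `σ = (χ i)` of characters of `G` lies in `Σ` if and only if, for every `E ∈ 𝓔` and all
finitely many distinct indices, the points `(χ i x)` with `x ∈ E` are dense in the corresponding
finite power of `𝕋[n_E]`. The proof rests on an approximation lemma, `finite_not_approximable`: if
`E` is almost `n`-torsion, `O` is a nonempty open set of characters and `y ∈ 𝕋[n]`, then for all but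
finitely many `x ∈ E` some `χ ∈ O` has `χ x` as close to `y` as desired. Since only finitely many
`x` fail, one `x ∈ E` serves finitely many open sets and targets at once, so that finitely many
nonempty open sets of characters can be shrunk until all choices from them map `E` onto a
`δ`-dense set (`exists_refinement_isSpread`).

Density and the Baire property follow together once every nonempty open set `W` and every sequence
of dense open sets `O k` of `Hom(G, 𝕋 ^ ι)` have a common point in the set in question
(`isDenseBaire_of_forall_inter_nonempty`). Such a point is built as in the Baire category theorem,
with a Cantor scheme to handle uncountably many coordinates (`exists_generic_family`). Entering all
`O k` takes individual open conditions on countably many coordinates only. The other indices are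
coded by binary sequences, and an open condition is attached to every node of the binary tree. At
each stage the conditions are refined to enter `O k` and to be `δ`-spread. In the limit, finitely
many indices are separated by a late stage, whence the density of their joint images.

All conditions depend on the values of the characters on a countable subgroup `H` only, and the
limit can be arranged to separate the points of `H` on half of the coordinates. When
`|G| ≤ 2 ^ 𝔠`, the group `G` embeds in `𝕋 ^ ι` (`exists_injective_hom_pi`), and the divisibility of
`𝕋` permits changing the other half of the characters outside `H` so that the result is injective
(`exists_injective_agreeing`). Conversely, `𝕋 ^ ι` has only `2 ^ 𝔠` elements.
-/

open Topology

namespace KroneckerWeyl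

/-! ### Extension of characters -/

section Extension

/-- Divisible groups are injective: a homomorphism `g` into a divisible group factors through `f`
as soon as `g` vanishes on the kernel of `f`. -/
theorem exists_factor_of_ker_le {A B D : Type*} [AddCommGroup A] [AddCommGroup B]
    [AddCommGroup D] [DivisibleBy D ℤ] (f : A →+ B) (g : A →+ D) (h : f.ker ≤ g.ker) :
    ∃ k : B →+ D, ∀ a, k (f a) = g a := by
  obtain ⟨k, hk⟩ := Module.Baer.extension_property_addMonoidHom (Module.Baer.of_divisible D)
    (QuotientAddGroup.kerLift f) (QuotientAddGroup.kerLift_injective f)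
    (QuotientAddGroup.lift f.ker g h)
  exact ⟨k, fun a => DFunLike.congr_fun hk (a : A ⧸ f.ker)⟩

/-- The values at `x` of the characters that vanish on `L` fill `𝕋[m]`, where `m` is the order of
`x` modulo `L`. -/
theorem exists_hom_eq_zero_on_apply_eq {G : Type*} [AddCommGroup G] (L : AddSubgroup G) (x : G)
    (t : UnitAddCircle) (ht : addOrderOf (x : G ⧸ L) • t = 0) :
    ∃ ψ : G →+ UnitAddCircle, (∀ l ∈ L, ψ l = 0) ∧ ψ x = t := by
  obtain ⟨k, hk⟩ := exists_factor_of_ker_le (zmultiplesHom (G ⧸ L) (x : G ⧸ L))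
    (zmultiplesHom UnitAddCircle t) (by
      intro z hz
      rw [AddMonoidHom.mem_ker, zmultiplesHom_apply] at hz ⊢
      obtain ⟨w, rfl⟩ := addOrderOf_dvd_iff_zsmul_eq_zero.2 hz
      rw [mul_comm, mul_zsmul, natCast_zsmul, ht, zsmul_zero])
  refine ⟨k.comp (QuotientAddGroup.mk' L), fun l hl => ?_, ?_⟩
  · simp [(QuotientAddGroup.eq_zero_iff l).2 hl]
  · simpa using hk 1

theorem exists_torsion_ne_zero {m : ℕ} (hm : m ≠ 1) : ∃ t : UnitAddCircle, m • t = 0 ∧ t ≠ 0 := by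
  rcases Nat.eq_zero_or_pos m with rfl | hpos
  · refine ⟨((1 / 2 : ℝ) : UnitAddCircle), zero_nsmul _, fun h => ?_⟩
    have := AddCircle.addOrderOf_period_div (p := (1 : ℝ)) (n := 2) (by norm_num)
    rw [show ((1 : ℝ) / (2 : ℕ)) = 1 / 2 by norm_num, h] at this
    simp at this
  · have := AddCircle.addOrderOf_period_div (p := (1 : ℝ)) hpos
    refine ⟨((1 / m : ℝ) : UnitAddCircle), ?_, fun h => ?_⟩
    · rw [← addOrderOf_dvd_iff_nsmul_eq_zero, this]
    · rw [h, addOrderOf_zero] at this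
      exact hm this.symm

theorem exists_character_ne_zero {G : Type*} [AddCommGroup G] {x : G} (hx : x ≠ 0) :
    ∃ ψ : G →+ UnitAddCircle, ψ x ≠ 0 := by
  have h1 : addOrderOf (x : G ⧸ (⊥ : AddSubgroup G)) ≠ 1 := by
    rw [Ne, AddMonoid.addOrderOf_eq_one_iff, QuotientAddGroup.eq_zero_iff]
    simpa using hx
  obtain ⟨t, ht, ht0⟩ := exists_torsion_ne_zero h1
  obtain ⟨ψ, -, h⟩ := exists_hom_eq_zero_on_apply_eq ⊥ x t ht
  exact ⟨ψ, h ▸ ht0⟩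

end Extension

/-! ### Embedding groups of size at most `2 ^ 𝔠` -/

section Embedding

/-- Characters of a free module that separate its points. The basis is indexed injectively by points
of the Cantor cube `2 ^ N`, and for each clopen cylinder, given by a finite set `p.1` of coordinates
and a pattern `p.2`, there is the character that is `θ` on the basis elements inside the cylinder
and `0` on the others. -/
theorem exists_separating_of_basis {I N R L : Type*} [Nonempty N] [Ring R] [AddCommGroup L]
    [Module R L] (b : Module.Basis I R L) (e : I → N → Bool) (he : Function.Injective e)
    (θ : R →+ UnitAddCircle) (hθ : Function.Injective θ) :
    ∃ φ : Finset N × Finset N → (L →+ UnitAddCircle), ∀ x ≠ 0, ∃ p, φ p x ≠ 0 := by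
  classical
  let Q : Finset N × Finset N → I → Prop := fun p i => ∀ r ∈ p.1, e i r = decide (r ∈ p.2)
  refine ⟨fun p => (Finsupp.liftAddHom fun i => if Q p i then θ else 0).comp
    (b.repr : L →+ (I →₀ R)), fun x hx => ?_⟩
  have h0 : b.repr x ≠ 0 := by simpa using hx
  obtain ⟨i, hi⟩ := Finsupp.support_nonempty_iff.2 h0
  have hd : ∀ j, j ≠ i → ∃ r, e j r ≠ e i r := fun j hj => by
    by_contra! hcon
    exact hj (he (funext hcon))
  choose! d hd using hd
  -- A cylinder that contains `i` and no other index from the support of `x`.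
  refine ⟨⟨((b.repr x).support.erase i).image d,
    (((b.repr x).support.erase i).image d).filter fun r => e i r = true⟩, ?_⟩
  have key : ∀ j ∈ (b.repr x).support, Q ⟨((b.repr x).support.erase i).image d,
    (((b.repr x).support.erase i).image d).filter fun r => e i r = true⟩ j ↔ j = i := by
    intro j hj
    constructor
    · intro hQ
      by_contra hne
      have hm : d j ∈ ((b.repr x).support.erase i).image d :=
        Finset.mem_image_of_mem d (Finset.mem_erase.2 ⟨hne, hj⟩)
      have := hQ (d j) hm
      refine hd j hne ?_
      rw [this]
      simp only [Finset.mem_filter, hm, true_and, Bool.decide_eq_true]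
    · rintro rfl r hr
      simp only [Finset.mem_filter, hr, true_and, Bool.decide_eq_true]
  simp only [AddMonoidHom.comp_apply, Finsupp.liftAddHom_apply, Finsupp.sum]
  change ∑ j ∈ (b.repr x).support, (if Q _ j then θ else 0) (b.repr x j) ≠ 0
  rw [Finset.sum_eq_single_of_mem i hi]
  · rw [if_pos ((key i hi).2 rfl)]
    intro h
    exact (Finsupp.mem_support_iff.1 hi) (hθ (by simpa using h))
  · intro j hj hne
    rw [if_neg (fun h => hne ((key j hj).1 h))]
    rfl

theorem exists_int_hom_injective : ∃ θ : ℤ →+ UnitAddCircle, Function.Injective θ := by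
  refine ⟨zmultiplesHom _ ((√2 : ℝ) : UnitAddCircle), ?_⟩
  rw [injective_iff_map_eq_zero]
  intro k hk
  rw [zmultiplesHom_apply, ← AddCircle.coe_zsmul, AddCircle.coe_eq_zero_iff] at hk
  obtain ⟨n, hn⟩ := hk
  by_contra h0
  have hirr : Irrational (k * √2) := irrational_sqrt_two.intCast_mul h0
  apply hirr.ne_int n
  simpa using hn.symm

/-- Every element of infinite order has a multiple that is nonzero and lies in a free subgroup
chosen beforehand; the characters of `exists_separating_of_basis` are extended from it. -/
theorem exists_separating_infinite_order {G N : Type*} [Nonempty N] [AddCommGroup G]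
    (e : G → N → Bool) (he : Function.Injective e) :
    ∃ φ : Finset N × Finset N → (G →+ UnitAddCircle),
      ∀ x : G, addOrderOf x = 0 → ∃ p, φ p x ≠ 0 := by
  obtain ⟨s, hs, hmax⟩ := exists_maximal_linearIndepOn ℤ (id : G → G)
  obtain ⟨θ, hθ⟩ := exists_int_hom_injective
  obtain ⟨φ, hφ⟩ := exists_separating_of_basis (Module.Basis.span hs) (fun i => e i.1)
    (he.comp Subtype.val_injective) θ hθ
  have hext := fun p => exists_factor_of_ker_le
    (Submodule.span ℤ (Set.range fun i : s => (id i.1 : G))).toAddSubgroup.subtype (φ p)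
    (fun z hz => by
      have : z = 0 := by simpa using hz
      subst this; exact zero_mem _)
  choose ψ hψ using hext
  refine ⟨ψ, fun x hx => ?_⟩
  have hsub : ∃ a : ℤ, a ≠ 0 ∧ a • x ∈ Submodule.span ℤ (Set.range fun i : s => (id i.1 : G)) := by
    by_cases hxs : x ∈ s
    · exact ⟨1, one_ne_zero, by rw [one_smul]; exact Submodule.subset_span ⟨⟨x, hxs⟩, rfl⟩⟩
    · obtain ⟨a, ha, h⟩ := hmax x hxs
      refine ⟨a, ha, ?_⟩
      rwa [Set.image_eq_range] at h
  obtain ⟨a, ha, hmem⟩ := hsub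
  have hne : a • x ≠ 0 := fun h => ha (by
    have := addOrderOf_dvd_iff_zsmul_eq_zero.2 h
    rwa [hx, Nat.cast_zero, zero_dvd_iff] at this)
  obtain ⟨p, hp⟩ := hφ ⟨a • x, hmem⟩ (fun h => hne (congrArg Subtype.val h))
  refine ⟨p, fun h => hp ?_⟩
  rw [← hψ p ⟨a • x, hmem⟩]
  show ψ p (a • x) = 0
  rw [map_zsmul, h, zsmul_zero]

theorem exists_separating_prime_order {G N : Type*} [Nonempty N] [AddCommGroup G]
    (e : G → N → Bool) (he : Function.Injective e) (p : ℕ) [hp : Fact p.Prime] :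
    ∃ φ : Finset N × Finset N → (G →+ UnitAddCircle),
      ∀ x : G, x ≠ 0 → p • x = 0 → ∃ q, φ q x ≠ 0 := by
  let L : AddSubgroup G := (nsmulAddMonoidHom (α := G) p).ker
  let _ : Module (ZMod p) L := AddCommGroup.zmodModule (fun x => Subtype.ext x.2)
  let b := Module.Basis.ofVectorSpace (ZMod p) L
  obtain ⟨φ, hφ⟩ := exists_separating_of_basis b (fun i => e (i.1 : L))
    (he.comp (Subtype.val_injective.comp Subtype.val_injective)) ZMod.toAddCircle
    (ZMod.toAddCircle_injective p)
  have hext := fun q => exists_factor_of_ker_le L.subtype (φ q)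
    (fun z hz => by
      have : z = 0 := by simpa using hz
      subst this; exact zero_mem _)
  choose ψ hψ using hext
  refine ⟨ψ, fun x hx hpx => ?_⟩
  obtain ⟨q, hq⟩ := hφ ⟨x, hpx⟩ (fun h => hx (congrArg Subtype.val h))
  exact ⟨q, fun h => hq ((hψ q ⟨x, hpx⟩).symm.trans h)⟩

/-- A group of size at most `2 ^ 𝔠` embeds in `𝕋 ^ 𝔠`: a nonzero element has infinite order or a
multiple of prime order, and `𝔠` characters separate each of these countably many kinds. -/
theorem exists_injective_hom_pi {G ι : Type*} [AddCommGroup G]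
    (hι : Cardinal.mk ι = Cardinal.continuum) (hG : Cardinal.mk G ≤ 2 ^ Cardinal.continuum) :
    ∃ σ : G →+ (ι → UnitAddCircle), Function.Injective σ := by
  obtain ⟨e, he⟩ : ∃ e : G → (ℕ → Bool) → Bool, Function.Injective e := by
    have : Cardinal.lift.{0} (Cardinal.mk G) ≤
        Cardinal.lift (Cardinal.mk ((ℕ → Bool) → Bool)) := by
      simpa using hG
    obtain ⟨f⟩ := Cardinal.lift_mk_le'.1 this
    exact ⟨f, f.injective⟩
  let N := ℕ → Bool
  obtain ⟨φ, hφ⟩ := exists_separating_infinite_order e he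
  have hp := fun p : {p : ℕ // p.Prime} =>
    have := Fact.mk p.2
    exists_separating_prime_order e he p.1
  choose ψ hψ using hp
  let τ : Option {p : ℕ // p.Prime} × (Finset N × Finset N) → (G →+ UnitAddCircle) :=
    fun q => q.1.elim (φ q.2) (fun p => ψ p q.2)
  have hτ : ∀ x ≠ 0, ∃ q, τ q x ≠ 0 := by
    intro x hx
    by_cases h0 : addOrderOf x = 0
    · obtain ⟨q, hq⟩ := hφ x h0
      exact ⟨⟨none, q⟩, hq⟩
    · have h1 : addOrderOf x ≠ 1 := by rwa [Ne, AddMonoid.addOrderOf_eq_one_iff]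
      obtain ⟨p, hp, m, hm⟩ := Nat.exists_prime_and_dvd h1
      obtain ⟨q, hq⟩ := hψ ⟨p, hp⟩ (m • x) (fun h => by
          have hm0 : 0 < m := Nat.pos_of_ne_zero (by rintro rfl; simp [hm] at h0)
          have hd := Nat.le_of_dvd hm0 (addOrderOf_dvd_iff_nsmul_eq_zero.2 h)
          rw [hm] at hd
          nlinarith [hp.two_le])
        (by rw [← mul_nsmul', ← hm, addOrderOf_nsmul_eq_zero])
      refine ⟨⟨some ⟨p, hp⟩, q⟩, fun h => hq ?_⟩
      rw [map_nsmul, show ψ ⟨p, hp⟩ q x = 0 from h, nsmul_zero]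
  obtain ⟨u, hu⟩ : ∃ u : ι → Option {p : ℕ // p.Prime} × (Finset N × Finset N),
      Function.Surjective u := by
    have : Cardinal.lift (Cardinal.mk (Option {p : ℕ // p.Prime} × (Finset N × Finset N))) ≤
        Cardinal.lift.{0} (Cardinal.mk ι) := by
      rw [hι]
      have hN : Cardinal.mk (Finset N) = Cardinal.continuum := by
        rw [Cardinal.mk_finset_of_infinite]; simp [N]
      have : Cardinal.mk (Option {p : ℕ // p.Prime}) ≤ Cardinal.continuum :=
        Cardinal.mk_le_aleph0.trans Cardinal.aleph0_le_continuum
      rw [Cardinal.mk_prod, Cardinal.mk_prod, hN]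
      simp only [Cardinal.lift_id, Cardinal.continuum_mul_self, Cardinal.lift_continuum]
      calc Cardinal.lift _ ≤ Cardinal.lift (Cardinal.continuum * Cardinal.continuum) :=
            Cardinal.lift_le.2 (mul_le_mul_left this _)
        _ = _ := by simp
    obtain ⟨f⟩ := Cardinal.lift_mk_le'.1 this
    have : Nonempty (Option {p : ℕ // p.Prime} × (Finset N × Finset N)) := ⟨⟨none, ∅, ∅⟩⟩
    exact ⟨Function.invFun f, Function.invFun_surjective f.injective⟩
  refine ⟨AddMonoidHom.pi fun i => τ (u i), ?_⟩
  rw [injective_iff_map_eq_zero]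
  intro x hx
  by_contra hne
  obtain ⟨q, hq⟩ := hτ x hne
  obtain ⟨i, rfl⟩ := hu q
  exact hq (congrFun hx i)

end Embedding

/-! ### Approximation on almost torsion sets -/

section Approximation

variable {G : Type*} [AddCommGroup G]

theorem continuous_eval (x : G) : Continuous fun χ : G →+ UnitAddCircle => χ x :=
  (continuous_apply x).comp continuous_induced_dom

theorem exists_forall_ball_subset {α : Type*} (t : Finset α) {u : α → Set UnitAddCircle}
    {y : α → UnitAddCircle} (h : ∀ a ∈ t, IsOpen (u a) ∧ y a ∈ u a) :
    ∃ ε > 0, ∀ a ∈ t, Metric.ball (y a) ε ⊆ u a := by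
  have hball : ∀ a ∈ t, ∃ ε > 0, Metric.ball (y a) ε ⊆ u a := fun a ha =>
    Metric.isOpen_iff.1 (h a ha).1 _ (h a ha).2
  choose! r hr hru using hball
  rcases t.eq_empty_or_nonempty with rfl | ht
  · exact ⟨1, one_pos, by simp⟩
  · exact ⟨t.inf' ht r, (Finset.lt_inf'_iff ht).2 hr, fun a ha =>
      (Metric.ball_subset_ball (Finset.inf'_le r ha)).trans (hru a ha)⟩

theorem exists_finset_ball_subset {O : Set (G →+ UnitAddCircle)} (hO : IsOpen O)
    {χ₀ : G →+ UnitAddCircle} (h : χ₀ ∈ O) :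
    ∃ (A : Finset G) (ε : ℝ), 0 < ε ∧
      ∀ χ : G →+ UnitAddCircle, (∀ a ∈ A, dist (χ a) (χ₀ a) < ε) → χ ∈ O := by
  obtain ⟨V, hV, rfl⟩ := isOpen_induced_iff.1 hO
  obtain ⟨A, u, hu, hsub⟩ := isOpen_pi_iff.1 hV χ₀ h
  obtain ⟨ε, hε, hball⟩ := exists_forall_ball_subset A hu
  exact ⟨A, ε, hε, fun χ hχ => hsub fun a ha => hball a ha (hχ a ha)⟩

/-- On a finitely generated subgroup `L`, finitely many real-valued homomorphisms, the coordinates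
of the free part of `L`, are jointly bounded only on finite sets. -/
theorem exists_real_homs_finite (L : AddSubgroup G) [AddGroup.FG L] :
    ∃ (r : ℕ) (ρ : Fin r → (G →+ ℝ)), ∀ R : ℝ, {l | l ∈ L ∧ ∀ j, |ρ j l| ≤ R}.Finite := by
  obtain ⟨r, κ, _, p, hp, k, ⟨e⟩⟩ := AddCommGroup.equiv_free_prod_directSum_zmod L
  have hfin : Finite (DirectSum κ fun i => ZMod (p i ^ k i)) := by
    have : ∀ i, NeZero (p i ^ k i) := fun i => ⟨pow_ne_zero _ (hp i).ne_zero⟩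
    exact Finite.of_equiv _ (DirectSum.addEquivProd fun i => ZMod (p i ^ k i)).symm.toEquiv
  let f : Fin r → (L →+ ℝ) := fun j => (Int.castAddHom ℝ).comp
    ((Finsupp.applyAddHom j).comp ((AddMonoidHom.fst _ _).comp e.toAddMonoidHom))
  have hext := fun j => exists_factor_of_ker_le L.subtype (f j) (fun z hz => by
      have : z = 0 := by simpa using hz
      subst this; exact zero_mem _)
  choose ρ hρ using hext
  refine ⟨r, ρ, fun R => ?_⟩
  let F : L → (Fin r → ℤ) × (DirectSum κ fun i => ZMod (p i ^ k i)) :=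
    fun l => (fun j => (e l).1 j, (e l).2)
  have hF : Function.Injective F := by
    intro l l' h
    apply e.injective
    have h1 := congrArg Prod.fst h
    have h2 : (F l).2 = (F l').2 := congrArg Prod.snd h
    exact Prod.ext (Finsupp.ext fun j => congrFun h1 j) h2
  have h1 : ((Set.univ.pi fun _ : Fin r => Set.Icc (-⌈R⌉) ⌈R⌉) ×ˢ
      (Set.univ : Set (DirectSum κ fun i => ZMod (p i ^ k i)))).Finite :=
    (Set.Finite.pi fun _ => Set.finite_Icc _ _).prod Set.finite_univ
  refine ((h1.preimage hF.injOn).image Subtype.val).subset ?_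
  rintro l ⟨hl, hR⟩
  refine ⟨⟨l, hl⟩, ⟨fun j _ => ?_, trivial⟩, rfl⟩
  have h2 := hR j
  rw [show ρ j l = (((e ⟨l, hl⟩).1 j : ℤ) : ℝ) from hρ j ⟨l, hl⟩, abs_le] at h2
  have h3 := Int.le_ceil R
  constructor
  · have : ((-⌈R⌉ : ℤ) : ℝ) ≤ (((e ⟨l, hl⟩).1 j : ℤ) : ℝ) := by push_cast; linarith
    exact_mod_cast this
  · have : (((e ⟨l, hl⟩).1 j : ℤ) : ℝ) ≤ ((⌈R⌉ : ℤ) : ℝ) := by linarith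
    exact_mod_cast this

theorem norm_coe_le_abs (s : ℝ) : ‖(s : UnitAddCircle)‖ ≤ |s| := by
  simpa using QuotientAddGroup.norm_mk_le_norm (S := AddSubgroup.zmultiples (1 : ℝ)) (m := s)

theorem exists_torsion_dist_lt {m : ℕ} {δ : ℝ} (hm : 0 < m) (hδ : 1 / (m : ℝ) < δ)
    (z : UnitAddCircle) : ∃ t : UnitAddCircle, m • t = 0 ∧ dist t z < δ := by
  obtain ⟨s, rfl⟩ := QuotientAddGroup.mk_surjective z
  have hm' : (0 : ℝ) < m := by exact_mod_cast hm
  refine ⟨((round (s * m) / m : ℝ) : UnitAddCircle), ?_, ?_⟩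
  · rw [← AddCircle.coe_nsmul, AddCircle.coe_eq_zero_iff]
    refine ⟨round (s * m), ?_⟩
    simp only [zsmul_eq_mul, mul_one, nsmul_eq_mul]
    field_simp
  · rw [dist_eq_norm]
    refine lt_of_le_of_lt (norm_coe_le_abs (round (s * m) / m - s)) (lt_of_le_of_lt ?_ hδ)
    have : (round (s * m) / m - s : ℝ) = (round (s * m) - s * m) / m := by field_simp
    rw [this, abs_div, abs_of_pos hm']
    gcongr
    have := abs_sub_round (s * m)
    rw [abs_sub_comm] at this
    linarith

/-- The approximation lemma. Let `χ₀` be in the open set `O`, which constrains its members on a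
finitely generated subgroup `L` only. If some real-valued homomorphism `ρ` is large at `x`, then
`χ₀ + tρ` with `t` small takes any value at `x`. If not, and the order `m` of `x` modulo `L` is `n`
or large, then adding characters that vanish on `L` works. All other `x` satisfy `m x ∈ L` for a
proper divisor `m` of `n` from a finite set, and `m x` is in a finite subset of `L`. -/
theorem finite_not_approximable {n : ℕ} {E : Set G} (hE : IsAlmostTorsion n E)
    {O : Set (G →+ UnitAddCircle)} (hO : IsOpen O) (hne : O.Nonempty) {y : UnitAddCircle}
    (hy : y ∈ torsionSet UnitAddCircle n) {δ : ℝ} (hδ : 0 < δ) :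
    {x | x ∈ E ∧ ¬ ∃ χ ∈ O, dist (χ x) y < δ}.Finite := by
  obtain ⟨χ₀, hχ₀⟩ := hne
  obtain ⟨A, ε, hε, hA⟩ := exists_finset_ball_subset hO hχ₀
  let L := AddSubgroup.closure (A : Set G)
  have hAL : ∀ a ∈ A, a ∈ L := fun a ha => AddSubgroup.subset_closure ha
  have : AddGroup.FG L := AddGroup.closure_finset_fg A
  obtain ⟨r, ρ, hρ⟩ := exists_real_homs_finite L
  obtain ⟨C, hC0, hC⟩ : ∃ C : ℝ, 0 ≤ C ∧ ∀ j, ∀ a ∈ A, |ρ j a| ≤ C := by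
    refine ⟨∑ j, ∑ a ∈ A, |ρ j a|, by positivity, fun j a ha => ?_⟩
    exact (Finset.single_le_sum (f := fun a => |ρ j a|) (fun _ _ => abs_nonneg _) ha).trans
      (Finset.single_le_sum (f := fun j => ∑ a ∈ A, |ρ j a|) (fun _ _ => by positivity)
        (Finset.mem_univ j))
  let R : ℝ := (C + 1) / ε
  have hR : 0 < R := by positivity
  obtain ⟨M, hM⟩ := exists_nat_one_div_lt hδ
  -- The bound `n + M` on `d` omits no proper divisor when `n ≠ 0`, and ensures that `𝕋[d]` is
  -- `δ`-dense for the omitted `d` when `n = 0`.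
  have hfin : (⋃ d ∈ {d | d ∈ Set.Iic (n + M) ∧ IsProperDivisor d n},
      {x | x ∈ E ∧ d • x ∈ L ∧ ∀ j, |ρ j x| ≤ R}).Finite := by
    refine Set.Finite.biUnion ((Set.finite_Iic _).subset fun d hd => hd.1) fun d hd => ?_
    refine Set.Finite.of_finite_fibers (fun x => d • x) ((hρ (d * R)).subset ?_) ?_
    · rintro _ ⟨x, ⟨-, hx, hb⟩, rfl⟩
      refine ⟨hx, fun j => ?_⟩
      simp only [map_nsmul, nsmul_eq_mul, abs_mul, Nat.abs_cast]
      exact mul_le_mul_of_nonneg_left (hb j) (Nat.cast_nonneg d)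
    · intro g _
      exact (hE.finite_fiber d hd.2 g).subset fun x hx => ⟨hx.1.1, hx.2⟩
  refine hfin.subset ?_
  rintro x ⟨hxE, hx⟩
  have hnx : n • x = 0 := hE.subset hxE
  by_contra hout
  simp only [Set.mem_iUnion, not_exists, Set.mem_ofPred_eq] at hout
  apply hx
  by_cases hbig : ∃ j, R < |ρ j x|
  · obtain ⟨j, hj⟩ := hbig
    obtain ⟨s, hs⟩ : ∃ s : ℝ, |s| ≤ 1 ∧ (s : UnitAddCircle) = y - χ₀ x := by
      obtain ⟨z, hz⟩ := QuotientAddGroup.mk_surjective (y - χ₀ x)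
      refine ⟨Int.fract z, ?_, ?_⟩
      · rw [abs_of_nonneg (Int.fract_nonneg z)]
        exact (Int.fract_lt_one z).le
      · rw [← hz]
        refine sub_eq_zero.1 ?_
        rw [show (z : UnitAddCircle) = _ from rfl, ← AddCircle.coe_sub, AddCircle.coe_eq_zero_iff]
        exact ⟨-⌊z⌋, by simp⟩
    have hpos : 0 < |ρ j x| := hR.trans hj
    let t : ℝ := s / ρ j x
    let ψ : G →+ UnitAddCircle := (QuotientAddGroup.mk' (AddSubgroup.zmultiples (1 : ℝ))).comp
      ((AddMonoidHom.mulLeft t).comp (ρ j))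
    have hψ : ∀ g, ψ g = ((t * ρ j g : ℝ) : UnitAddCircle) := fun g => rfl
    refine ⟨χ₀ + ψ, hA _ fun a ha => ?_, ?_⟩
    · rw [AddMonoidHom.add_apply, dist_eq_norm, add_sub_cancel_left, hψ]
      refine (norm_coe_le_abs _).trans_lt ?_
      have ht : |t| ≤ 1 / R := by
        rw [abs_div]
        exact div_le_div₀ zero_le_one hs.1 hR hj.le
      rw [abs_mul]
      calc |t| * |ρ j a| ≤ 1 / R * C := mul_le_mul ht (hC j a ha) (abs_nonneg _) (by positivity)
        _ = ε * (C / (C + 1)) := by simp only [R]; field_simp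
        _ < ε * 1 := by
          gcongr
          rw [div_lt_one (by positivity)]
          linarith
        _ = ε := mul_one ε
    · rw [AddMonoidHom.add_apply, hψ, div_mul_cancel₀ s (abs_pos.1 hpos), hs.2,
        add_sub_cancel, dist_self]
      exact hδ
  · push Not at hbig
    let m := addOrderOf (x : G ⧸ L)
    have hmL : m • x ∈ L := by
      rw [← QuotientAddGroup.eq_zero_iff, QuotientAddGroup.mk_nsmul]
      exact addOrderOf_nsmul_eq_zero _
    have hmn : m ∣ n := by
      rw [addOrderOf_dvd_iff_nsmul_eq_zero, ← QuotientAddGroup.mk_nsmul, hnx,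
        QuotientAddGroup.mk_zero]
    obtain ⟨t, ht, htd⟩ : ∃ t : UnitAddCircle, m • t = 0 ∧ dist t (y - χ₀ x) < δ := by
      by_cases hmn' : m = n
      · refine ⟨y - χ₀ x, ?_, by rwa [dist_self]⟩
        rw [hmn', nsmul_sub, ← map_nsmul, hnx, map_zero, sub_zero]
        exact hy
      · have hm0 : m ≠ 0 := fun h0 => hmn' (by rw [h0] at hmn ⊢; exact (zero_dvd_iff.1 hmn).symm)
        have hlarge : n + M < m := by
          by_contra hle
          exact hout m ⟨not_lt.1 hle, hm0, hmn', hmn⟩ ⟨hxE, hmL, hbig⟩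
        refine exists_torsion_dist_lt (Nat.pos_of_ne_zero hm0) (lt_of_le_of_lt ?_ hM) _
        apply one_div_le_one_div_of_le (by positivity)
        exact_mod_cast (by omega : M + 1 ≤ m)
    obtain ⟨ψ, hψL, hψx⟩ := exists_hom_eq_zero_on_apply_eq L x t ht
    refine ⟨χ₀ + ψ, hA _ fun a ha => ?_, ?_⟩
    · rw [AddMonoidHom.add_apply, hψL a (hAL a ha), add_zero, dist_self]
      exact hε
    · rw [AddMonoidHom.add_apply, hψx]
      rw [dist_eq_norm] at htd ⊢
      rwa [show χ₀ x + t - y = t - (y - χ₀ x) by abel]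

end Approximation

/-! ### Refining open conditions -/

section Refinement

variable {G : Type*} [AddCommGroup G]

theorem isClosedEmbedding_coe_hom :
    IsClosedEmbedding (fun χ : G →+ UnitAddCircle => (χ : G → UnitAddCircle)) := by
  refine ⟨⟨⟨rfl⟩, DFunLike.coe_injective⟩, ?_⟩
  have : Set.range (fun χ : G →+ UnitAddCircle => (χ : G → UnitAddCircle)) =
      ⋂ (x : G) (y : G), {f | f (x + y) = f x + f y} := by
    ext f
    simp only [Set.mem_range, Set.mem_iInter, Set.mem_ofPred_eq]
    constructor
    · rintro ⟨χ, rfl⟩ x y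
      exact map_add χ x y
    · intro h
      exact ⟨AddMonoidHom.mk' f h, rfl⟩
  rw [this]
  refine isClosed_iInter fun x => isClosed_iInter fun y => isClosed_eq (continuous_apply _) ?_
  exact (continuous_apply x).add (continuous_apply y)

instance : CompactSpace (G →+ UnitAddCircle) := isClosedEmbedding_coe_hom.compactSpace

instance : T2Space (G →+ UnitAddCircle) := isClosedEmbedding_coe_hom.isEmbedding.t2Space

/-- A family of nonempty open sets of characters. -/
def IsOpenFamily {κ : Type*} (U : κ → Set (G →+ UnitAddCircle)) : Prop :=
  ∀ a, IsOpen (U a) ∧ (U a).Nonempty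

/-- Membership in `S` depends only on the values of a character on `A`. -/
def IsDeterminedBy (A : Finset G) (S : Set (G →+ UnitAddCircle)) : Prop :=
  ∀ χ ∈ S, ∀ χ' : G →+ UnitAddCircle, (∀ g ∈ A, χ' g = χ g) → χ' ∈ S

theorem IsDeterminedBy.mono {A A' : Finset G} {S : Set (G →+ UnitAddCircle)}
    (h : IsDeterminedBy A S) (hA : A ⊆ A') : IsDeterminedBy A' S :=
  fun χ hχ χ' h' => h χ hχ χ' fun g hg => h' g (hA hg)

/-- Every point of `𝕋[n] ^ C` is `δ`-close to `(χ a x)` for some `x ∈ E`, and the same `x` serves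
all choices of characters `χ a ∈ U a`. The target `y` is defined on all of `κ`, but only its values
on `C` matter. -/
def IsSpread {κ : Type*} (C : Finset κ) (n : ℕ) (E : Set G) (δ : ℝ)
    (U : κ → Set (G →+ UnitAddCircle)) : Prop :=
  ∀ y : κ → UnitAddCircle, (∀ a, y a ∈ torsionSet UnitAddCircle n) →
    ∃ x ∈ E, ∀ a ∈ C, ∀ χ ∈ U a, dist (χ x) (y a) < δ

theorem exists_refinement_forall {κ τ : Type*} (S : Finset τ)
    (P : τ → (κ → Set (G →+ UnitAddCircle)) → Prop)
    (hmono : ∀ t U U', U' ≤ U → P t U → P t U')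
    (h : ∀ t ∈ S, ∀ U, IsOpenFamily U → ∃ U' ≤ U, IsOpenFamily U' ∧ P t U') :
    ∀ U, IsOpenFamily U → ∃ U' ≤ U, IsOpenFamily U' ∧ ∀ t ∈ S, P t U' := by
  classical
  induction S using Finset.induction_on with
  | empty => exact fun U hU => ⟨U, le_rfl, hU, by simp⟩
  | insert t S _ ih =>
    intro U hU
    obtain ⟨U₁, h₁, ho₁, hP₁⟩ := ih (fun t ht => h t (Finset.mem_insert_of_mem ht)) U hU
    obtain ⟨U₂, h₂, ho₂, hP₂⟩ := h t (Finset.mem_insert_self t S) U₁ ho₁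
    refine ⟨U₂, h₂.trans h₁, ho₂, fun s hs => ?_⟩
    rcases Finset.mem_insert.1 hs with rfl | hs
    · exact hP₂
    · exact hmono s U₁ U₂ h₂ (hP₁ s hs)

theorem exists_refinement_dist_lt {κ : Type*} (C : Finset κ) {n : ℕ} {E : Set G}
    (hE : IsAlmostTorsion n E) {δ : ℝ} (hδ : 0 < δ) {y : κ → UnitAddCircle}
    (hy : ∀ a, y a ∈ torsionSet UnitAddCircle n) {U : κ → Set (G →+ UnitAddCircle)}
    (hU : IsOpenFamily U) :
    ∃ U' ≤ U, IsOpenFamily U' ∧ ∃ x ∈ E, ∀ a ∈ C, ∀ χ ∈ U' a, dist (χ x) (y a) < δ := by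
  have hbad : (⋃ a ∈ C, {x | x ∈ E ∧ ¬ ∃ χ ∈ U a, dist (χ x) (y a) < δ}).Finite :=
    Set.Finite.biUnion C.finite_toSet fun a _ =>
      finite_not_approximable hE (hU a).1 (hU a).2 (hy a) hδ
  obtain ⟨x, hxE, hx⟩ := hE.infinite.exists_notMem_finite hbad
  have hx' : ∀ a ∈ C, ∃ χ ∈ U a, dist (χ x) (y a) < δ := by
    intro a ha
    by_contra hcon
    exact hx (Set.mem_biUnion (Finset.mem_coe.2 ha) ⟨hxE, hcon⟩)
  refine ⟨fun a => {χ | χ ∈ U a ∧ (a ∈ C → dist (χ x) (y a) < δ)}, fun a χ hχ => hχ.1, ?_,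
    x, hxE, fun a ha χ hχ => hχ.2 ha⟩
  intro a
  by_cases ha : a ∈ C
  · simp only [ha, true_imp_iff]
    have hopen : IsOpen {χ : G →+ UnitAddCircle | dist (χ x) (y a) < δ} :=
      isOpen_lt ((continuous_eval x).dist continuous_const) continuous_const
    exact ⟨(hU a).1.inter hopen, hx' a ha⟩
  · simpa only [ha, false_imp_iff, and_true, Set.ofPred_mem_eq] using hU a

theorem exists_refinement_isSpread {κ : Type*} (C : Finset κ) {n : ℕ} {E : Set G}
    (hE : IsAlmostTorsion n E) {δ : ℝ} (hδ : 0 < δ) {U : κ → Set (G →+ UnitAddCircle)}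
    (hU : IsOpenFamily U) : ∃ U' ≤ U, IsOpenFamily U' ∧ IsSpread C n E δ U' := by
  classical
  -- By compactness it is enough to approximate the points of a finite net of `𝕋[n] ^ C`.
  obtain ⟨Y, hYsub, hYfin, hYcov⟩ := Metric.finite_approx_of_totallyBounded
    ((isCompact_univ (X := UnitAddCircle)).totallyBounded.subset
      (Set.subset_univ (torsionSet UnitAddCircle n))) _ (half_pos hδ)
  have := hYfin.fintype
  let z : (C → Y) → κ → UnitAddCircle := fun t a => if h : a ∈ C then t ⟨a, h⟩ else 0
  have hz : ∀ t a, z t a ∈ torsionSet UnitAddCircle n := by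
    intro t a
    by_cases h : a ∈ C
    · simp only [z, h, dif_pos]
      exact hYsub (t ⟨a, h⟩).2
    · simp only [z, h, dif_neg, not_false_eq_true]
      exact nsmul_zero n
  obtain ⟨U', hle, ho, hP⟩ := exists_refinement_forall (Finset.univ : Finset (C → Y))
    (fun t U => ∃ x ∈ E, ∀ a ∈ C, ∀ χ ∈ U a, dist (χ x) (z t a) < δ / 2)
    (fun t U U' hle ⟨x, hx, h⟩ => ⟨x, hx, fun a ha χ hχ => h a ha χ (hle a hχ)⟩)
    (fun t _ U hU => exists_refinement_dist_lt C hE (half_pos hδ) (hz t) hU) U hU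
  refine ⟨U', hle, ho, fun y hy => ?_⟩
  have hnear : ∀ a : C, ∃ t : Y, dist (y a) t < δ / 2 := by
    intro a
    obtain ⟨t, ht, hd⟩ := Set.mem_iUnion₂.1 (hYcov (hy a))
    exact ⟨⟨t, ht⟩, hd⟩
  choose t ht using hnear
  obtain ⟨x, hx, h⟩ := hP t (Finset.mem_univ t)
  refine ⟨x, hx, fun a ha χ hχ => ?_⟩
  have h1 := h a ha χ hχ
  have h2 := ht ⟨a, ha⟩
  simp only [z, ha, dif_pos] at h1
  rw [dist_comm] at h2
  linarith [dist_triangle (χ x) (t ⟨a, ha⟩ : UnitAddCircle) (y a)]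

theorem exists_refinement_closure {κ : Type*} {U : κ → Set (G →+ UnitAddCircle)}
    (hU : IsOpenFamily U) :
    ∃ U' ≤ U, IsOpenFamily U' ∧ (∀ a, closure (U' a) ⊆ U a) ∧
      ∃ A : κ → Finset G, ∀ a, IsDeterminedBy (A a) (U' a) := by
  choose χ hχ using fun a => (hU a).2
  choose A ε hε hA using fun a => exists_finset_ball_subset (hU a).1 (hχ a)
  let U' : κ → Set (G →+ UnitAddCircle) := fun a =>
    ⋂ g ∈ A a, {ψ | dist (ψ g) (χ a g) < ε a / 2}
  have hcl : ∀ a, closure (U' a) ⊆ U a := by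
    intro a
    have hclosed : IsClosed (⋂ g ∈ A a,
        {ψ : G →+ UnitAddCircle | dist (ψ g) (χ a g) ≤ ε a / 2}) :=
      isClosed_biInter fun g _ =>
        isClosed_le ((continuous_eval g).dist continuous_const) continuous_const
    refine (closure_minimal ?_ hclosed).trans fun ψ hψ => hA a ψ fun g hg => ?_
    · exact Set.iInter₂_mono fun g _ ψ (hψ : dist (ψ g) (χ a g) < ε a / 2) => hψ.le
    · exact lt_of_le_of_lt (Set.mem_iInter₂.1 hψ g hg) (half_lt_self (hε a))
  refine ⟨U', fun a => subset_closure.trans (hcl a), fun a => ⟨?_, χ a, ?_⟩, hcl, A, ?_⟩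
  · exact isOpen_biInter_finset fun g _ =>
      isOpen_lt ((continuous_eval g).dist continuous_const) continuous_const
  · exact Set.mem_iInter₂.2 fun g _ => by
      simpa only [Set.mem_ofPred_eq, dist_self] using half_pos (hε a)
  · intro a ψ hψ ψ' h
    refine Set.mem_iInter₂.2 fun g hg => ?_
    rw [Set.mem_ofPred_eq, h g hg]
    exact Set.mem_iInter₂.1 hψ g hg

theorem exists_box_subset {ι : Type*} {O : Set (ι → (G →+ UnitAddCircle))} (hO : IsOpen O)
    (F : Finset ι) {U : ι → Set (G →+ UnitAddCircle)} (hU : IsOpenFamily U)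
    (hne : ((F : Set ι).pi U ∩ O).Nonempty) :
    ∃ (F' : Finset ι) (U' : ι → Set (G →+ UnitAddCircle)), F ⊆ F' ∧ IsOpenFamily U' ∧
      (∀ i ∈ F, U' i ⊆ U i) ∧ (F' : Set ι).pi U' ⊆ O := by
  classical
  obtain ⟨σ, hσF, hσO⟩ := hne
  obtain ⟨I, u, hu, hsub⟩ := isOpen_pi_iff.1 hO σ hσO
  refine ⟨F ∪ I, fun i => (if i ∈ I then u i else Set.univ) ∩ (if i ∈ F then U i else Set.univ),
    Finset.subset_union_left, fun i => ⟨IsOpen.inter ?_ ?_, σ i, ?_, ?_⟩, fun i hi => ?_, ?_⟩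
  · split_ifs with h
    exacts [(hu i h).1, isOpen_univ]
  · split_ifs with h
    exacts [(hU i).1, isOpen_univ]
  · split_ifs with h
    exacts [(hu i h).2, trivial]
  · split_ifs with h
    exacts [hσF i h, trivial]
  · simp only [if_pos hi]
    exact Set.inter_subset_right
  · refine fun τ hτ => hsub fun i hi => ?_
    have := (hτ i (Finset.mem_coe.2 (Finset.mem_union_right F hi))).1
    rwa [if_pos (Finset.mem_coe.1 hi)] at this

theorem isOpen_exists_apply_ne_zero {ι : Type*} (I : Set ι) (g : G) :
    IsOpen {σ : ι → (G →+ UnitAddCircle) | ∃ i ∈ I, σ i g ≠ 0} := by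
  have : {σ : ι → (G →+ UnitAddCircle) | ∃ i ∈ I, σ i g ≠ 0} =
      ⋃ i ∈ I, {σ | σ i g ≠ 0} := by
    ext σ; simp
  rw [this]
  exact isOpen_biUnion fun i _ =>
    isOpen_ne_fun ((continuous_eval g).comp (continuous_apply i)) continuous_const

theorem dense_exists_apply_ne_zero {ι : Type*} {I : Set ι} (hI : I.Infinite) {g : G}
    (hg : g ≠ 0) : Dense {σ : ι → (G →+ UnitAddCircle) | ∃ i ∈ I, σ i g ≠ 0} := by
  classical
  rw [dense_iff_inter_open]
  rintro W hW ⟨σ, hσ⟩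
  obtain ⟨F, u, hu, hsub⟩ := isOpen_pi_iff.1 hW σ hσ
  obtain ⟨i, hi, hiF⟩ := hI.exists_notMem_finset F
  obtain ⟨ψ, hψ⟩ := exists_character_ne_zero hg
  refine ⟨Function.update σ i ψ, hsub fun j hj => ?_, i, hi, by simpa using hψ⟩
  have hji : j ≠ i := by
    rintro rfl
    exact hiF hj
  rw [Function.update_of_ne hji]
  exact (hu j hj).2

end Refinement

/-! ### Generic families of characters -/

section Construction

variable {G : Type*} [AddCommGroup G] {ι : Type*}

/-- A stage of the construction: open conditions on the characters with index in the finite set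
`F`, open conditions attached to the nodes of the binary tree, to be imposed on the other indices
according to their codes in `ℕ → Bool`, and a finite subset `A` of the group. The conditions in use
depend only on the values of the characters on `A`, except possibly at the initial stage. -/
structure Stage (G : Type*) [AddCommGroup G] (ι : Type*) where
  F : Finset ι
  U : ι ⊕ List Bool → Set (G →+ UnitAddCircle)
  A : Finset G
  isOpenFamily : IsOpenFamily U

/-- The cells in use at stage `k`: the indices in `F` and the tree nodes of level `k`. -/
noncomputable def activeCells (F : Finset ι) (k : ℕ) : Finset (ι ⊕ List Bool) :=
  F.disjSum (List.finite_length_eq Bool k).toFinset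

/-- The stage `s'` is a successor of the stage `s`, which is number `k`. A list stands for the
tree node reached by its entries in reverse order, so that the parent of a node is its tail. -/
structure Stage.Next (I : Set ι) (O : Set (ι → (G →+ UnitAddCircle))) (E : ℕ → Set G)
    (n : ℕ → ℕ) (k : ℕ) (s s' : Stage G ι) : Prop where
  F_subset : s.F ⊆ s'.F
  A_subset : s.A ⊆ s'.A
  sub_mem : ∀ g ∈ s.A, ∀ h ∈ s.A, g - h ∈ s'.A
  closure_inl : ∀ i ∈ s.F, closure (s'.U (.inl i)) ⊆ s.U (.inl i)
  closure_inr : ∀ l, closure (s'.U (.inr l)) ⊆ s.U (.inr l.tail)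
  box_mem : ∀ σ : ι → (G →+ UnitAddCircle), (∀ i ∈ s'.F, σ i ∈ s'.U (.inl i)) →
    σ ∈ O ∧ ∀ g ∈ s.A, g ≠ 0 → ∃ i ∈ I, σ i g ≠ 0
  spread : ∀ j ≤ k, IsSpread (activeCells s'.F (k + 1)) (n j) (E j) (1 / ((k : ℝ) + 1)) s'.U
  determined : ∀ a ∈ activeCells s'.F (k + 1), IsDeterminedBy s'.A (s'.U a)

theorem IsSpread.mono {κ : Type*} {C : Finset κ} {n : ℕ} {E : Set G} {δ : ℝ}
    {U U' : κ → Set (G →+ UnitAddCircle)} (h : IsSpread C n E δ U) (hle : U' ≤ U) :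
    IsSpread C n E δ U' := fun y hy => by
  obtain ⟨x, hx, h⟩ := h y hy
  exact ⟨x, hx, fun a ha χ hχ => h a ha χ (hle a hχ)⟩

theorem Stage.exists_next {I : Set ι} (hI : I.Infinite) {O : Set (ι → (G →+ UnitAddCircle))}
    (hO : IsOpen O) (hOd : Dense O) {E : ℕ → Set G} {n : ℕ → ℕ}
    (hE : ∀ j, IsAlmostTorsion (n j) (E j)) (k : ℕ) (s : Stage G ι) :
    ∃ s' : Stage G ι, s.Next I O E n k s' := by
  classical
  let D : G → Set (ι → (G →+ UnitAddCircle)) := fun g => {σ | ∃ i ∈ I, σ i g ≠ 0}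
  let B := s.A.erase 0
  have hDo : IsOpen (⋂ g ∈ B, D g) :=
    isOpen_biInter_finset fun g _ => isOpen_exists_apply_ne_zero I g
  have hDd : Dense (⋂ g ∈ B, D g) :=
    dense_biInter_of_isOpen (S := (B : Set G)) (fun g _ => isOpen_exists_apply_ne_zero I g)
      B.countable_toSet fun g hg => dense_exists_apply_ne_zero hI (Finset.ne_of_mem_erase hg)
  have hU : IsOpenFamily fun i => s.U (.inl i) := fun i => s.isOpenFamily _
  have hbox : IsOpen ((s.F : Set ι).pi fun i => s.U (.inl i)) :=
    isOpen_set_pi s.F.finite_toSet fun i _ => (hU i).1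
  obtain ⟨F', U₁, hF', hU₁, hsub₁, hO₁⟩ := exists_box_subset (hO.inter hDo) s.F hU
    ((hOd.inter_of_isOpen_left hDd hO).inter_open_nonempty _ hbox
      (by choose χ hχ using fun i => (hU i).2; exact ⟨χ, fun i _ => hχ i⟩))
  let U₂ : ι ⊕ List Bool → Set (G →+ UnitAddCircle) :=
    Sum.elim U₁ fun l => s.U (.inr l.tail)
  have hU₂ : IsOpenFamily U₂ := by
    rintro (i | l)
    exacts [hU₁ i, s.isOpenFamily _]
  obtain ⟨U₃, hle₃, hU₃, hs₃⟩ := exists_refinement_forall (Finset.range (k + 1))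
    (fun j => IsSpread (activeCells F' (k + 1)) (n j) (E j) (1 / ((k : ℝ) + 1)))
    (fun _ _ _ hle h => h.mono hle)
    (fun j _ U hU => exists_refinement_isSpread _ (hE j) (by positivity) hU) U₂ hU₂
  obtain ⟨U₄, hle₄, hU₄, hcl, A, hA⟩ := exists_refinement_closure hU₃
  have hle : U₄ ≤ U₂ := hle₄.trans hle₃
  refine ⟨⟨F', U₄, s.A ∪ Finset.image₂ (· - ·) s.A s.A ∪ (activeCells F' (k + 1)).biUnion A, hU₄⟩,
    hF', ?_, ?_, ?_, ?_, ?_, ?_, ?_⟩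
  · exact Finset.subset_union_left.trans Finset.subset_union_left
  · exact fun g hg h hh => Finset.mem_union_left _ (Finset.mem_union_right _
      (Finset.mem_image₂_of_mem hg hh))
  · exact fun i hi => ((hcl _).trans (hle₃ _)).trans (hsub₁ i hi)
  · exact fun l => (hcl _).trans (hle₃ _)
  · intro σ hσ
    obtain ⟨h1, h2⟩ := hO₁ (fun i hi => hle (.inl i) (hσ i hi) : σ ∈ (F' : Set ι).pi U₁)
    exact ⟨h1, fun g hg h0 => Set.mem_iInter₂.1 h2 g (Finset.mem_erase.2 ⟨h0, hg⟩)⟩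
  · exact fun j hj => (hs₃ j (Finset.mem_range.2 (by omega))).mono hle₄
  · exact fun a ha => (hA a).mono
      ((Finset.subset_biUnion_of_mem A ha).trans Finset.subset_union_right)

open Classical in
/-- The cell that the index `i` occupies at stage `k` of a sequence of stages: its own one if `i`
enters some `F`, and otherwise the tree node given by the first `k` digits of its code. -/
noncomputable def cell (s : ℕ → Stage G ι) (f : ι → ℕ → Bool) (i : ι) (k : ℕ) : ι ⊕ List Bool :=
  if ∃ m, i ∈ (s m).F then .inl i else .inr (PiNat.res (f i) k)

theorem eventually_cell_ne (s : ℕ → Stage G ι) {f : ι → ℕ → Bool} (hf : Function.Injective f)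
    {i j : ι} (hij : i ≠ j) : ∀ᶠ k in Filter.atTop, cell s f i k ≠ cell s f j k := by
  obtain ⟨m, hm⟩ : ∃ m, f i m ≠ f j m := by
    by_contra! h
    exact hij (hf (funext h))
  filter_upwards [Filter.eventually_gt_atTop m] with k hk
  unfold cell
  split_ifs
  · simpa using hij
  · simp
  · simp
  · intro h
    exact hm (PiNat.res_eq_res.1 (Sum.inr_injective h) hk)

/-- The conditions imposed on the character with index `i` decrease from some stage on, and its
cell is in use from then on. If `i` enters some `F`, then it changes its cell at that stage, and the
conditions imposed on it earlier are dropped. -/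
theorem exists_start {I : Set ι} {O : ℕ → Set (ι → (G →+ UnitAddCircle))} {E : ℕ → Set G}
    {n : ℕ → ℕ} {s : ℕ → Stage G ι} (hs : ∀ k, (s k).Next I (O k) E n k (s (k + 1)))
    (f : ι → ℕ → Bool) (i : ι) :
    ∃ K, (∀ m, i ∈ (s m).F → K ≤ m) ∧ ∀ k ≥ K, cell s f i k ∈ activeCells (s k).F k ∧
      closure ((s (k + 1)).U (cell s f i (k + 1))) ⊆ (s k).U (cell s f i k) := by
  classical
  have hmono : Monotone fun k => (s k).F := monotone_nat_of_le_succ fun k => (hs k).F_subset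
  by_cases h : ∃ m, i ∈ (s m).F
  · refine ⟨Nat.find h, fun m hm => Nat.find_min' h hm, fun k hk => ?_⟩
    have hi : i ∈ (s k).F := hmono hk (Nat.find_spec h)
    simp only [cell, if_pos h]
    exact ⟨Finset.inl_mem_disjSum.2 hi, (hs k).closure_inl i hi⟩
  · refine ⟨0, fun m _ => m.zero_le, fun k _ => ?_⟩
    simp only [cell, if_neg h]
    refine ⟨Finset.inr_mem_disjSum.2 (by simp), ?_⟩
    exact (hs k).closure_inr (PiNat.res (f i) (k + 1))

/-- A sequence of stages yields a subgroup `H` and characters `χ i` such that all families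
of characters agreeing with `χ` on `H` satisfy the conditions of all stages. -/
theorem exists_generic_family {I : Set ι} (hI : I.Infinite) {f : ι → ℕ → Bool}
    (hf : Function.Injective f) {E : ℕ → Set G} {n : ℕ → ℕ}
    (hE : ∀ j, IsAlmostTorsion (n j) (E j)) {W : Set (ι → (G →+ UnitAddCircle))}
    (hW : IsOpen W) (hWne : W.Nonempty) {O : ℕ → Set (ι → (G →+ UnitAddCircle))}
    (hO : ∀ k, IsOpen (O k)) (hOd : ∀ k, Dense (O k)) :
    ∃ (H : AddSubgroup G) (χ : ι → (G →+ UnitAddCircle)),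
      (∀ g ∈ H, g ≠ 0 → ∃ i ∈ I, χ i g ≠ 0) ∧
      ∀ σ : ι → (G →+ UnitAddCircle), (∀ i, ∀ g ∈ H, σ i g = χ i g) →
        σ ∈ W ∧ (∀ k, σ ∈ O k) ∧ ∀ j, ∀ y : ι → UnitAddCircle,
          (∀ i, y i ∈ torsionSet UnitAddCircle (n j)) → ∀ (t : Finset ι), ∀ δ > 0,
            ∃ x ∈ E j, ∀ i ∈ t, dist (σ i x) (y i) < δ := by
  classical
  obtain ⟨F₀, U₀, -, hU₀, -, hW₀⟩ := exists_box_subset hW ∅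
    (U := fun _ => Set.univ) (fun _ => ⟨isOpen_univ, Set.univ_nonempty⟩) (by simpa using hWne)
  let s₀ : Stage G ι := ⟨F₀, Sum.elim U₀ fun _ => Set.univ, {0}, by
    rintro (i | l)
    exacts [hU₀ i, ⟨isOpen_univ, Set.univ_nonempty⟩]⟩
  choose next hnext using fun k s => Stage.exists_next hI (hO k) (hOd k) hE k s
  let s : ℕ → Stage G ι := fun k => Nat.rec s₀ (fun k s => next k s) k
  have hs : ∀ k, (s k).Next I (O k) E n k (s (k + 1)) := fun k => hnext k (s k)
  have hAmono : Monotone fun k => (s k).A := monotone_nat_of_le_succ fun k => (hs k).A_subset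
  let H : AddSubgroup G := AddSubgroup.ofSub {g | ∃ k, g ∈ (s k).A}
    ⟨0, 0, Finset.mem_singleton_self 0⟩ (by
      rintro g ⟨k, hg⟩ h ⟨l, hh⟩
      rw [← sub_eq_add_neg]
      exact ⟨max k l + 1, (hs (max k l)).sub_mem g (hAmono (le_max_left k l) hg) h
        (hAmono (le_max_right k l) hh)⟩)
  have hH : ∀ k, ∀ g ∈ (s k).A, g ∈ H := fun k g hg => ⟨k, hg⟩
  choose K hKF hK using exists_start hs f
  have hχ : ∀ i, ∃ χ : G →+ UnitAddCircle, ∀ k ≥ K i, χ ∈ (s k).U (cell s f i k) := by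
    intro i
    obtain ⟨χ, hχ⟩ := IsCompact.nonempty_iInter_of_sequence_nonempty_isCompact_isClosed
      (fun m => closure ((s (K i + m + 1)).U (cell s f i (K i + m + 1))))
      (fun m => ((hK i (K i + (m + 1)) (by omega)).2).trans subset_closure)
      (fun m => ((s (K i + m + 1)).isOpenFamily _).2.closure) isClosed_closure.isCompact
      (fun m => isClosed_closure)
    refine ⟨χ, fun k hk => ?_⟩
    obtain ⟨m, rfl⟩ := Nat.exists_eq_add_of_le hk
    exact (hK i _ (by omega)).2 (Set.mem_iInter.1 hχ m)
  choose χ hχ using hχ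
  have hσ : ∀ σ : ι → (G →+ UnitAddCircle), (∀ i, ∀ g ∈ H, σ i g = χ i g) →
      ∀ i, ∀ k ≥ K i, σ i ∈ (s k).U (cell s f i k) := by
    intro σ h i k hk
    -- The initial stage need not be determined by its finite set, the next one is.
    refine (hK i k hk).2 (subset_closure ?_)
    have h1 : k + 1 ≥ K i := by omega
    exact (hs k).determined _ (hK i (k + 1) h1).1 _ (hχ i (k + 1) h1) _
      fun g hg => h i g (hH (k + 1) g hg)
  have hcell : ∀ i k, i ∈ (s k).F → cell s f i k = .inl i := fun i k h => if_pos ⟨k, h⟩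
  have hσF : ∀ σ : ι → (G →+ UnitAddCircle), (∀ i, ∀ g ∈ H, σ i g = χ i g) →
      ∀ k, ∀ i ∈ (s k).F, σ i ∈ (s k).U (.inl i) := by
    intro σ h k i hi
    have := hσ σ h i k (hKF i k hi)
    rwa [hcell i k hi] at this
  refine ⟨H, χ, ?_, fun σ h => ⟨hW₀ fun i hi => hσF σ h 0 i hi, fun k => ?_, ?_⟩⟩
  · rintro g ⟨k, hg⟩ h0
    exact ((hs k).box_mem χ (hσF χ (fun _ _ _ => rfl) (k + 1))).2 g hg h0
  · exact ((hs k).box_mem σ (hσF σ h (k + 1))).1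
  · intro j y hy t δ hδ
    -- Late enough, the indices in `t` occupy different active cells.
    have hsep : ∀ᶠ k in Filter.atTop, ∀ i ∈ t, ∀ i' ∈ t, i ≠ i' →
        cell s f i k ≠ cell s f i' k :=
      (Filter.eventually_all_finset t).2 fun i _ => (Filter.eventually_all_finset t).2 fun i' _ =>
        Filter.eventually_imp_distrib_left.2 fun hne => eventually_cell_ne s hf hne
    have hlate : ∀ᶠ k in Filter.atTop, ∀ i ∈ t, K i ≤ k :=
      (Filter.eventually_all_finset t).2 fun i _ => Filter.eventually_ge_atTop _
    have hsmall : ∀ᶠ k : ℕ in Filter.atTop, 1 / ((k : ℝ) + 1) < δ :=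
      (tendsto_one_div_add_atTop_nhds_zero_nat (𝕜 := ℝ)).eventually (gt_mem_nhds hδ)
    obtain ⟨k, hksep, hklate, hksmall, hkj⟩ := (((Filter.tendsto_add_atTop_nat 1).eventually
      hsep).and (hlate.and (hsmall.and (Filter.eventually_ge_atTop j)))).exists
    let z : ι ⊕ List Bool → UnitAddCircle := fun a =>
      if h : ∃ i ∈ t, cell s f i (k + 1) = a then y h.choose else 0
    have hz : ∀ i ∈ t, z (cell s f i (k + 1)) = y i := by
      intro i hi
      have hex : ∃ i' ∈ t, cell s f i' (k + 1) = cell s f i (k + 1) := ⟨i, hi, rfl⟩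
      simp only [z, dif_pos hex]
      congr 1
      by_contra hne
      exact hksep _ hex.choose_spec.1 i hi hne hex.choose_spec.2
    obtain ⟨x, hx, hd⟩ := (hs k).spread j hkj z (by
      intro a
      by_cases hex : ∃ i ∈ t, cell s f i (k + 1) = a
      · simp only [z, dif_pos hex]
        exact hy _
      · simp only [z, dif_neg hex]
        exact nsmul_zero _)
    refine ⟨x, hx, fun i hi => ?_⟩
    have hk1 : k + 1 ≥ K i := (hklate i hi).trans k.le_succ
    have := hd _ (hK i (k + 1) hk1).1 _ (hσ σ h i (k + 1) hk1)
    rw [hz i hi] at this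
    exact this.trans hksmall

end Construction

/-! ### Density, the Baire property and injectivity -/

section Conclusion

theorem isDenseBaire_of_forall_inter_nonempty {X : Type*} [TopologicalSpace X] {A : Set X}
    (h : ∀ W : Set X, IsOpen W → W.Nonempty → ∀ O : ℕ → Set X, (∀ k, IsOpen (O k)) →
      (∀ k, Dense (O k)) → ∃ a ∈ A, a ∈ W ∧ ∀ k, a ∈ O k) : IsDenseBaire A := by
  have hA : Dense A := by
    rw [dense_iff_inter_open]
    intro W hW hne
    obtain ⟨a, ha, haW, -⟩ := h W hW hne (fun _ => Set.univ) (fun _ => isOpen_univ)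
      fun _ => dense_univ
    exact ⟨a, haW, ha⟩
  refine ⟨hA, ⟨fun f ho hd => ?_⟩⟩
  choose O hO hOf using fun k => isOpen_induced_iff.1 (ho k)
  have hOd : ∀ k, Dense (O k) := fun k => by
    refine (hA.denseRange_val.dense_image continuous_subtype_val (hd k)).mono ?_
    rw [← hOf k]
    exact Set.image_preimage_subset _ _
  rw [dense_iff_inter_open]
  rintro V hV ⟨v, hv⟩
  obtain ⟨W, hW, rfl⟩ := isOpen_induced_iff.1 hV
  obtain ⟨a, ha, haW, haO⟩ := h W hW ⟨v, hv⟩ O hO hOd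
  refine ⟨⟨a, ha⟩, haW, Set.mem_iInter.2 fun k => ?_⟩
  rw [← hOf k]
  exact haO k

variable {G : Type*} [AddCommGroup G] {ι : Type*}

theorem mem_sigmaSet_of_approx {𝓔 : Set (Set G)} {σ : G →+ (ι → UnitAddCircle)}
    (h𝓔 : ∀ E ∈ 𝓔, ∃ n, IsAlmostTorsion n E)
    (h : ∀ E ∈ 𝓔, ∀ n, IsAlmostTorsion n E → ∀ y : ι → UnitAddCircle,
      (∀ i, y i ∈ torsionSet UnitAddCircle n) → ∀ (t : Finset ι), ∀ δ > 0,
        ∃ x ∈ E, ∀ i ∈ t, dist (σ x i) (y i) < δ) : σ ∈ sigmaSet ι 𝓔 := by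
  intro E hE
  obtain ⟨n, hn⟩ := h𝓔 E hE
  rw [torsionIndex_eq hn]
  constructor
  · rintro _ ⟨x, hx, rfl⟩ i -
    change n • σ x i = 0
    rw [← Pi.smul_apply, ← map_nsmul, hn.subset hx, map_zero, Pi.zero_apply]
  · intro y hy
    rw [mem_closure_iff]
    intro o ho hyo
    obtain ⟨t, u, hu, hsub⟩ := isOpen_pi_iff.1 ho y hyo
    obtain ⟨δ, hδ, hball⟩ := exists_forall_ball_subset t hu
    obtain ⟨x, hx, hd⟩ := h E hE n hn y (fun i => hy i trivial) t δ hδ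
    exact ⟨σ x, hsub fun i hi => hball i hi (hd i hi), x, hx, rfl⟩

/-- If the coordinates in `I` of the characters `χ` separate the points of `H`, and there are `𝔠`
coordinates outside `I`, then `χ` may be changed without affecting its restriction to `H` so that
it separates the points of `G`. The kernel `N` of the coordinates in `I` meets `H` trivially, and so
the remaining coordinates can be prescribed on `N`. -/
theorem exists_injective_agreeing (hι : Cardinal.mk ι = Cardinal.continuum)
    (hG : Cardinal.mk G ≤ 2 ^ Cardinal.continuum) (H : AddSubgroup G) {I : Set ι} {r : ι → ι}
    (hr : Function.Injective r) (hrI : ∀ i, r i ∉ I) (χ : ι → (G →+ UnitAddCircle))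
    (hχ : ∀ g ∈ H, g ≠ 0 → ∃ i ∈ I, χ i g ≠ 0) :
    ∃ σ : ι → (G →+ UnitAddCircle), (∀ i, ∀ g ∈ H, σ i g = χ i g) ∧
      ∀ g, (∀ i, σ i g = 0) → g = 0 := by
  obtain ⟨e, he⟩ := exists_injective_hom_pi hι hG
  let N : AddSubgroup G := ⨅ i ∈ I, (χ i).ker
  have hN : ∀ g, g ∈ N ↔ ∀ i ∈ I, χ i g = 0 := fun g => by
    simp [N, AddSubgroup.mem_iInf, AddMonoidHom.mem_ker]
  have hext := fun i => exists_factor_of_ker_le ((QuotientAddGroup.mk' H).comp N.subtype)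
    (((Pi.evalAddMonoidHom (fun _ : ι => UnitAddCircle) i).comp e - χ (r i)).comp N.subtype)
    (by
      rintro ⟨g, hg⟩ hz
      have hgH : g ∈ H := (QuotientAddGroup.eq_zero_iff g).1 hz
      have hg0 : g = 0 := by
        by_contra hne
        obtain ⟨i, hi, h⟩ := hχ g hgH hne
        exact h ((hN g).1 hg i hi)
      subst hg0
      exact map_zero _)
  choose k hk using hext
  let σ := Function.extend r (fun i => χ (r i) + (k i).comp (QuotientAddGroup.mk' H)) χ
  have hσr : ∀ i, σ (r i) = χ (r i) + (k i).comp (QuotientAddGroup.mk' H) :=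
    fun i => hr.extend_apply _ _ i
  have hσ : ∀ i, (¬ ∃ j, r j = i) → σ i = χ i := fun i hi => Function.extend_apply' _ _ i hi
  refine ⟨σ, fun i g hg => ?_, fun g hg => ?_⟩
  · by_cases hi : ∃ j, r j = i
    · obtain ⟨j, rfl⟩ := hi
      simp [hσr, (QuotientAddGroup.eq_zero_iff g).2 hg]
    · rw [hσ i hi]
  · have hgN : g ∈ N := (hN g).2 fun i hi => by
      rw [← hσ i (by rintro ⟨j, rfl⟩; exact hrI j hi)]
      exact hg i
    refine he ?_
    rw [map_zero]
    funext i
    have h1 : χ (r i) g + k i (g : G ⧸ H) = 0 := by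
      rw [← hg (r i), hσr]
      rfl
    have h2 : k i (g : G ⧸ H) = e g i - χ (r i) g := hk i ⟨g, hgN⟩
    rw [h2, add_sub_cancel] at h1
    exact h1

theorem mk_le_of_injective_hom_pi (hι : Cardinal.mk ι = Cardinal.continuum)
    {σ : G →+ (ι → UnitAddCircle)} (hσ : Function.Injective σ) :
    Cardinal.mk G ≤ 2 ^ Cardinal.continuum := by
  have hT : Cardinal.mk UnitAddCircle ≤ Cardinal.continuum := by
    rw [← Cardinal.mk_real]
    exact Cardinal.mk_le_of_surjective (QuotientAddGroup.mk_surjective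
      (s := AddSubgroup.zmultiples (1 : ℝ)))
  have h := Cardinal.lift_mk_le_lift_mk_of_injective hσ
  rw [Cardinal.mk_pi, Cardinal.prod_const, hι] at h
  rw [← Cardinal.lift_le]
  refine h.trans ?_
  simp only [Cardinal.lift_power, Cardinal.lift_continuum, Cardinal.lift_lift, Cardinal.lift_two]
  refine (Cardinal.power_le_power_right (c := Cardinal.continuum)
    ((Cardinal.lift_le.2 hT).trans_eq Cardinal.lift_continuum)).trans_eq ?_
  exact Cardinal.power_self_eq Cardinal.aleph0_le_continuum

end Conclusion

end KroneckerWeyl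

theorem mainTheorem1 {G : Type*} [AddCommGroup G] {ι : Type*}
    (hι : Cardinal.mk ι = Cardinal.continuum)
    (𝓔 : Set (Set G)) (hne : 𝓔.Nonempty) (hcount : 𝓔.Countable)
    (hsub : 𝓔 ⊆ KroneckerWeyl.almostTorsionSets G) :
    KroneckerWeyl.IsDenseBaire (KroneckerWeyl.sigmaSet ι 𝓔) ∧
      (KroneckerWeyl.IsDenseBaire
          (KroneckerWeyl.sigmaSet ι 𝓔 ∩ KroneckerWeyl.monoSet G (ι → UnitAddCircle)) ↔
        Cardinal.mk G ≤ 2 ^ Cardinal.continuum) := by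
  open KroneckerWeyl in
  have h𝓔 : ∀ E ∈ 𝓔, ∃ n, IsAlmostTorsion n E := fun E hE => Set.mem_iUnion.1 (hsub hE)
  obtain ⟨E, rfl⟩ := hcount.exists_eq_range hne
  choose n hn using fun j => h𝓔 (E j) ⟨j, rfl⟩
  obtain ⟨f, hf⟩ : ∃ f : ι → ℕ → Bool, Function.Injective f := by
    obtain ⟨f⟩ := Cardinal.lift_mk_le'.1
      (show Cardinal.lift.{0} (Cardinal.mk ι) ≤ Cardinal.lift (Cardinal.mk (ℕ → Bool)) by
        simp [hι])
    exact ⟨f, f.injective⟩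
  have hinf : Infinite ι := by
    rw [Cardinal.infinite_iff, hι]
    exact Cardinal.aleph0_le_continuum
  let Φ := homPiHomeomorph G UnitAddCircle ι
  have key : ∀ I : Set ι, I.Infinite → ∀ W : Set (G →+ (ι → UnitAddCircle)), IsOpen W →
      W.Nonempty → ∀ O : ℕ → Set (G →+ (ι → UnitAddCircle)), (∀ k, IsOpen (O k)) →
      (∀ k, Dense (O k)) → ∃ (H : AddSubgroup G) (χ : ι → (G →+ UnitAddCircle)),
        (∀ g ∈ H, g ≠ 0 → ∃ i ∈ I, χ i g ≠ 0) ∧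
        ∀ σ : ι → (G →+ UnitAddCircle), (∀ i, ∀ g ∈ H, σ i g = χ i g) →
          Φ.symm σ ∈ sigmaSet ι (Set.range E) ∧ Φ.symm σ ∈ W ∧ ∀ k, Φ.symm σ ∈ O k := by
    intro I hI W hW hWne O hO hOd
    obtain ⟨H, χ, hsep, h⟩ := exists_generic_family hI hf hn
      (hW.preimage Φ.symm.continuous) (hWne.preimage Φ.symm.surjective)
      (fun k => (hO k).preimage Φ.symm.continuous)
      (fun k => (hOd k).preimage Φ.symm.isOpenMap)
    refine ⟨H, χ, hsep, fun σ hσ => ⟨?_, (h σ hσ).1, (h σ hσ).2.1⟩⟩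
    refine mem_sigmaSet_of_approx h𝓔 ?_
    rintro _ ⟨j, rfl⟩ m hm
    obtain rfl := hm.unique (hn j)
    exact (h σ hσ).2.2 j
  refine ⟨isDenseBaire_of_forall_inter_nonempty fun W hW hWne O hO hOd => ?_, fun h => ?_,
    fun hG => isDenseBaire_of_forall_inter_nonempty fun W hW hWne O hO hOd => ?_⟩
  · obtain ⟨H, χ, -, h⟩ := key Set.univ Set.infinite_univ W hW hWne O hO hOd
    exact ⟨Φ.symm χ, h χ fun _ _ _ => rfl⟩
  · obtain ⟨σ, -, hσ⟩ := h.1.nonempty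
    exact mk_le_of_injective_hom_pi hι hσ
  · obtain ⟨e⟩ : Nonempty (ι ⊕ ι ≃ ι) := by
      rw [← Cardinal.eq, Cardinal.mk_sum, hι]
      simp
    obtain ⟨H, χ, hsep, h⟩ := key (Set.range (e ∘ Sum.inl))
      (Set.infinite_range_of_injective (e.injective.comp Sum.inl_injective)) W hW hWne O hO hOd
    obtain ⟨σ, hσH, hσ⟩ := exists_injective_agreeing hι hG H (r := e ∘ Sum.inr)
      (e.injective.comp Sum.inr_injective) (by rintro i ⟨j, hj⟩; simp at hj) χ hsep
    obtain ⟨h1, h2⟩ := h σ hσH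
    refine ⟨Φ.symm σ, ⟨h1, ?_⟩, h2⟩
    refine (injective_iff_map_eq_zero (Φ.symm σ)).2 fun g hg => hσ g fun i => ?_
    exact congrFun hg i
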